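/- Let $X$ be $[0,1]$ or the unit circle $\mathbb{T}$, and let $A$ be a uniform algebra on $X$, that is, a subalgebra of the algebra $C(X)$ of continuous complex-valued functions on $X$ which contains the constants, separates the points of $X$ and is complete in the uniform norm. For $x\in X$ put $$M_x=\{f\in A: f(x)=0\},\qquad J_x=\{f\in A: f^{-1}(\{0\})\text{ is a neighbourhood of }x\},$$ and let $E=\{x\in X:\overline{J_x}\neq M_x\}$, where the closure is taken in $A$. Suppose that $A$ is $2$-local on $X$: whenever $f\in C(X)$ and there are $g_1,g_2\in A$ such that every point of $X$ has a neighbourhood on which $f$ agrees with $g_1$ or a neighbourhood on which $f$ agrees with $g_2$, then $f\in A$. Suppose also that $E$ is a meagre subset of $X$. Then $A$ is trivial, i.e. $A=C(X)$. -/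

import Mathlib

open scoped Topology

namespace UniformAlg

variable {X : Type*} [TopologicalSpace X] [CompactSpace X]

/-- A subalgebra of `C(X)` (over `ℂ`, so containing the constants) is a uniform algebra on `X` if it
separates the points of `X` and is complete in the uniform norm. -/
structure IsUniformAlgebra (A : Subalgebra ℂ C(X, ℂ)) : Prop where
  separatesPoints : ∀ x y : X, x ≠ y → ∃ f ∈ A, f x ≠ f y
  isComplete : IsComplete (A : Set C(X, ℂ))

/-- The ideal `M_x` of all functions in `A` that vanish at `x`. -/
def M (A : Subalgebra ℂ C(X, ℂ)) (x : X) : Ideal A where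
  carrier := {f | f.1 x = 0}
  zero_mem' := rfl
  add_mem' {f g} hf hg := by
    have hf' : f.1 x = 0 := hf
    have hg' : g.1 x = 0 := hg
    change f.1 x + g.1 x = 0
    rw [hf', hg', add_zero]
  smul_mem' c f hf := by
    have hf' : f.1 x = 0 := hf
    change c.1 x * f.1 x = 0
    rw [hf', mul_zero]

/-- The ideal `J_x` of all functions in `A` whose zero set is a neighbourhood of `x`. -/
def J (A : Subalgebra ℂ C(X, ℂ)) (x : X) : Ideal A where
  carrier := {f | {y | f.1 y = 0} ∈ 𝓝 x}
  zero_mem' := Filter.Eventually.of_forall fun _ => rfl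
  add_mem' {f g} hf hg := by
    filter_upwards [hf, hg] with y hfy hgy
    have hf' : f.1 y = 0 := hfy
    have hg' : g.1 y = 0 := hgy
    change f.1 y + g.1 y = 0
    rw [hf', hg', add_zero]
  smul_mem' c f hf := by
    filter_upwards [hf] with y hfy
    have hf' : f.1 y = 0 := hfy
    change c.1 y * f.1 y = 0
    rw [hf', mul_zero]

/-- The set `E` of all points `x` at which `A` is not strongly regular, that is, at which the
closure of `J_x` in `A` (with the uniform norm) is not `M_x`. -/
def nonStronglyRegularSet (A : Subalgebra ℂ C(X, ℂ)) : Set X :=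
  {x | closure (J A x : Set A) ≠ (M A x : Set A)}

/-- `A` is 2-local on `X`: a continuous function `f` belongs to `A` as soon as there are `g₁`, `g₂`
in `A` such that every point has a neighbourhood on which `f` agrees with `g₁` or a neighbourhood
on which `f` agrees with `g₂`. -/
def IsTwoLocal (A : Subalgebra ℂ C(X, ℂ)) : Prop :=
  ∀ f g₁ g₂ : C(X, ℂ), g₁ ∈ A → g₂ ∈ A →
    (∀ x : X, ∃ U ∈ 𝓝 x, (∀ y ∈ U, f y = g₁ y) ∨ (∀ y ∈ U, f y = g₂ y)) → f ∈ A

/-- `A` is trivial if it is all of `C(X)`. -/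
def IsTrivial (A : Subalgebra ℂ C(X, ℂ)) : Prop := A = ⊤

end UniformAlg

/-!
The argument is elementary; it uses only that the complement of the meagre set `E` is dense, by
Baire's theorem.

*Cutting.* Let `x ∉ E` be a point of `[0,1]` and let `f ∈ A` vanish at `x`. Then `f` is a uniform
limit of functions in `A` that vanish near `x`, and by 2-locality such a function stays in `A` when
it is replaced by `0` on `[x, 1]`. Hence `f · 1_[0,x] ∈ A`
(`IsTwoLocal.exists_indicator`). Adding constants, `A` is invariant under stopping
`f ↦ f (min · x)` for `x ∉ E`, and then for all `x`, because the stopped function depends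
continuously on `x` and `A` is closed.

*Steps.* Given `a < b`, choose `f ∈ A` nonconstant on `[a, b]` and let `y ∈ [a, b]` maximize
`|f y - f a|`. Then `(f (min · y) - f (min · a)) / (f y - f a)` is `0` on `[0, a]`, is `1` on
`[b, 1]`, and is bounded by `1` by the choice of `y` (`exists_bounded_step`). Every continuous
function is a uniform limit of constants plus linear combinations of such steps over fine
subdivisions, so `A = C([0,1])` (`eq_top_of_comp_min`).

*The circle.* Fix `q ∉ E` and parametrize the circle by `[0,1]` as a loop `π` based at `q`. For
another point `x ∉ E`, coprimality of `M_q` and `M_x` allows functions vanishing at both points to be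
cut at both (`mem_closure_of_notMem_of_notMem`). Stopping does not preserve functions on the circle,
but it preserves the space of multipliers `b ∈ C([0,1])` with `b · M_q ⊆ M_q`. That space is
therefore all of `C([0,1])` (`multiplierSpace_eq_top`), so `M_q` is a closed ideal of `C(𝕋)` with `q`
as its only common zero, and `A = ℂ + M_q = C(𝕋)` (`isTrivial_of_loop`).
-/

namespace UniformAlg

open Set

/-! ### Stopping-invariant spaces of functions on the interval -/

/-- A substitute for a continuous ramp: a function of sup norm at most `1` that is `0` up to `a` and
`1` from `b` on. -/
theorem exists_bounded_step {B : Submodule ℂ C(unitInterval, ℂ)}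
    (hmin : ∀ x : unitInterval, ∀ f ∈ B, ∃ g ∈ B, ∀ t, g t = f (min t x))
    {a b : unitInterval} (hab : a ≤ b) (hsep : ∃ f ∈ B, ∃ t ∈ Icc a b, f t ≠ f a) :
    ∃ u ∈ B, (∀ t ≤ a, u t = 0) ∧ (∀ t, ‖u t‖ ≤ 1) ∧ ∀ t, b ≤ t → u t = 1 := by
  obtain ⟨f, hf, t₀, ht₀, hne⟩ := hsep
  -- `y` maximizes `|f - f a|` on `[a, b]`, which makes the quotient below bounded by `1`.
  obtain ⟨y, hy, hmax⟩ := (isCompact_Icc (a := a) (b := b)).exists_isMaxOn (nonempty_Icc.2 hab)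
    (f := fun t => ‖f t - f a‖) (by fun_prop)
  have hpos : 0 < ‖f y - f a‖ :=
    (norm_pos_iff.2 (sub_ne_zero.2 hne)).trans_le (hmax ht₀)
  have hy0 : f y - f a ≠ 0 := norm_pos_iff.1 hpos
  obtain ⟨g, hg, hg'⟩ := hmin y f hf
  obtain ⟨k, hk, hk'⟩ := hmin a f hf
  have hval : ∀ t, ((f y - f a)⁻¹ • (g - k)) t
      = (f y - f a)⁻¹ * (f (min t y) - f (min t a)) := fun t => by simp [hg', hk']
  refine ⟨(f y - f a)⁻¹ • (g - k), B.smul_mem _ (B.sub_mem hg hk), fun t ht => ?_, fun t => ?_,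
    fun t ht => ?_⟩
  · rw [hval, min_eq_left ht, min_eq_left (ht.trans hy.1), sub_self, mul_zero]
  · rw [hval, norm_mul, norm_inv, inv_mul_le_one₀ hpos]
    rcases le_total t a with ht | ht
    · rw [min_eq_left ht, min_eq_left (ht.trans hy.1), sub_self, norm_zero]
      exact hpos.le
    · rw [min_eq_right ht]
      exact hmax (show min t y ∈ Icc a b from ⟨le_min ht hy.1, (min_le_right _ _).trans hy.2⟩)
  · rw [hval, min_eq_right (hy.2.trans ht), min_eq_right (hab.trans ht), inv_mul_cancel₀ hy0]

/-- A closed space of functions on the interval which contains the constants, is invariant under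
stopping `f ↦ f (min · x)` for a dense set of `x`, and is nonconstant on every interval is all of
`C([0,1])`: continuous functions are uniform limits of telescoping sums of bounded steps. -/
theorem eq_top_of_comp_min {B : Submodule ℂ C(unitInterval, ℂ)}
    (hcl : IsClosed (B : Set C(unitInterval, ℂ))) (h1 : (1 : C(unitInterval, ℂ)) ∈ B)
    (hsep : ∀ a b : unitInterval, a < b → ∃ f ∈ B, ∃ t ∈ Icc a b, f t ≠ f a)
    {D : Set unitInterval} (hD : Dense D)
    (hminD : ∀ x ∈ D, ∀ f ∈ B, ∃ g ∈ B, ∀ t, g t = f (min t x)) : B = ⊤ := by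
  have hmin : ∀ x : unitInterval, ∀ f ∈ B, ∃ g ∈ B, ∀ t, g t = f (min t x) := by
    intro x f hf
    let F : C(unitInterval, C(unitInterval, ℂ)) :=
      ContinuousMap.curry ⟨fun p => f (min p.2 p.1), by fun_prop⟩
    have hsub : D ⊆ F ⁻¹' B := by
      intro x hx
      obtain ⟨g, hg, hg'⟩ := hminD x hx f hf
      have : F x = g := by
        ext t
        exact (hg' t).symm
      rw [mem_preimage, this]
      exact hg
    have huniv := (hcl.preimage F.continuous).closure_subset_iff.2 hsub
    rw [hD.closure_eq] at huniv
    exact ⟨F x, huniv (mem_univ x), fun t => rfl⟩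
  refine eq_top_iff.2 fun h _ => ?_
  rw [← SetLike.mem_coe, ← hcl.closure_eq, Metric.mem_closure_iff]
  intro ε hε
  obtain ⟨p, hp0, hpm, ⟨n, hn⟩, hpc⟩ := exists_monotone_Icc_subset_open_cover_unitInterval
    (c := fun x : unitInterval => {t | ‖h t - h x‖ < ε / 8})
    (fun x => isOpen_lt (by fun_prop) continuous_const)
    (fun t _ => mem_iUnion.2 ⟨t, by simpa using hε⟩)
  have hosc : ∀ m, ∀ s ∈ Icc (p m) (p (m + 1)), ∀ t ∈ Icc (p m) (p (m + 1)),
      ‖h s - h t‖ ≤ ε / 4 := by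
    intro m s hs t ht
    obtain ⟨x, hx⟩ := hpc m
    have h1 : ‖h s - h x‖ < ε / 8 := hx hs
    have h2 : ‖h t - h x‖ < ε / 8 := hx ht
    have := norm_sub_le (h s - h x) (h t - h x)
    rw [sub_sub_sub_cancel_right] at this
    linarith
  -- `s` approximates `h` up to `p m` and is stopped there; each subdivision interval adds one step.
  have key : ∀ m, ∃ s ∈ B, (∀ t ≤ p m, ‖h t - s t‖ ≤ ε / 2) ∧ ∀ t, p m ≤ t → s t = h (p m) := by
    intro m
    induction m with
    | zero =>
      refine ⟨h (p 0) • 1, B.smul_mem _ h1, fun t ht => ?_, fun t _ => by simp⟩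
      have : t = p 0 := le_antisymm ht (hp0 ▸ unitInterval.nonneg')
      simpa [this] using (half_pos hε).le
    | succ m ih =>
      obtain ⟨s, hs, hs1, hs2⟩ := ih
      have hle : p m ≤ p (m + 1) := hpm m.le_succ
      rcases hle.eq_or_lt with heq | hlt
      · exact ⟨s, hs, by rwa [← heq], by rwa [← heq]⟩
      obtain ⟨u, hu, hu0, hu1, hu2⟩ := exists_bounded_step hmin hle (hsep _ _ hlt)
      refine ⟨s + (h (p (m + 1)) - h (p m)) • u, B.add_mem hs (B.smul_mem _ hu),
        fun t ht => ?_, fun t ht => ?_⟩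
      · rcases le_total t (p m) with htm | htm
        · simpa [hu0 t htm] using hs1 t htm
        · have e : h t - (s + (h (p (m + 1)) - h (p m)) • u) t
              = (h t - h (p m)) - (h (p (m + 1)) - h (p m)) * u t := by
            simp [hs2 t htm]
            ring
          have b1 := hosc m t ⟨htm, ht⟩ (p m) ⟨le_rfl, hle⟩
          have b2 := hosc m (p (m + 1)) ⟨hle, le_rfl⟩ (p m) ⟨le_rfl, hle⟩
          have b3 : ‖(h (p (m + 1)) - h (p m)) * u t‖ ≤ ε / 4 := by
            rw [norm_mul]
            exact (mul_le_of_le_one_right (norm_nonneg _) (hu1 t)).trans b2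
          rw [e]
          linarith [norm_sub_le (h t - h (p m)) ((h (p (m + 1)) - h (p m)) * u t)]
      · simp [hs2 t (hle.trans ht), hu2 t ht]
  obtain ⟨s, hs, hs1, -⟩ := key n
  refine ⟨s, hs, lt_of_le_of_lt ?_ (half_lt_self hε)⟩
  rw [ContinuousMap.dist_le (half_pos hε).le]
  intro t
  rw [dist_eq_norm]
  exact hs1 t (by rw [hn n le_rfl]; exact unitInterval.le_one')

/-! ### Cutting functions by 2-locality -/

section General

variable {X : Type*} [TopologicalSpace X] {A : Subalgebra ℂ C(X, ℂ)}

theorem IsTwoLocal.exists_indicator_of_eventually (hA : IsTwoLocal A) {g : C(X, ℂ)} (hg : g ∈ A)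
    {K : Set X} (hK : ∀ p ∈ frontier K, ∀ᶠ y in 𝓝 p, g y = 0) :
    ∃ h ∈ A, ∀ t, h t = K.indicator g t := by
  refine ⟨⟨K.indicator g, continuous_indicator (fun p hp => (hK p hp).self_of_nhds)
    g.continuous.continuousOn⟩, hA _ g 0 hg A.zero_mem fun x => ?_, fun t => rfl⟩
  by_cases hx : x ∈ frontier K
  · refine ⟨_, hK x hx, Or.inr fun y hy => ?_⟩
    have hy : g y = 0 := hy
    simp [hy]
  · by_cases hxK : x ∈ K
    · have hi : x ∈ interior K := by
        by_contra hi
        exact hx ⟨subset_closure hxK, hi⟩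
      exact ⟨_, isOpen_interior.mem_nhds hi, Or.inl fun y hy => by
        simp [interior_subset hy]⟩
    · have hi : x ∈ (closure K)ᶜ := fun hc => hx ⟨hc, fun hi => hxK (interior_subset hi)⟩
      refine ⟨_, isClosed_closure.isOpen_compl.mem_nhds hi, Or.inr fun y hy => ?_⟩
      have : y ∉ K := fun hyK => hy (subset_closure hyK)
      simp [this]

/-- The cutting lemma: `f` may be replaced by `0` off `K` if it is a uniform limit of elements of `A`
that vanish near the frontier of `K`. -/
theorem IsTwoLocal.exists_indicator [CompactSpace X] (hA : IsTwoLocal A)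
    (hcl : IsClosed (A : Set C(X, ℂ)))
    {K : Set X} {f : C(X, ℂ)}
    (hf : f ∈ closure {g : C(X, ℂ) | g ∈ A ∧ ∀ p ∈ frontier K, ∀ᶠ y in 𝓝 p, g y = 0}) :
    ∃ h ∈ A, ∀ t, h t = K.indicator f t := by
  have hf0 : ∀ p ∈ frontier K, f p = 0 := by
    intro p hp
    have hc : IsClosed {g : C(X, ℂ) | g p = 0} :=
      isClosed_eq (continuous_eval_const p) continuous_const
    exact closure_minimal (fun g hg => (hg.2 p hp).self_of_nhds) hc hf
  let h : C(X, ℂ) := ⟨K.indicator f, continuous_indicator hf0 f.continuous.continuousOn⟩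
  refine ⟨h, ?_, fun t => rfl⟩
  rw [← SetLike.mem_coe, ← hcl.closure_eq, Metric.mem_closure_iff]
  intro ε hε
  obtain ⟨g, ⟨hgA, hg⟩, hfg⟩ := Metric.mem_closure_iff.1 hf ε hε
  obtain ⟨k, hk, hk'⟩ := hA.exists_indicator_of_eventually hgA hg
  refine ⟨k, hk, lt_of_le_of_lt ((ContinuousMap.dist_le dist_nonneg).2 fun t => ?_) hfg⟩
  rw [hk', show h t = K.indicator f t from rfl]
  by_cases ht : t ∈ K
  · simpa [ht] using ContinuousMap.dist_apply_le_dist t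
  · simp [ht]

theorem mem_closure_of_notMem_nonStronglyRegularSet {x : X} (hx : x ∉ nonStronglyRegularSet A)
    {f : C(X, ℂ)} (hf : f ∈ A) (hfx : f x = 0) :
    f ∈ closure {g : C(X, ℂ) | g ∈ A ∧ ∀ᶠ y in 𝓝 x, g y = 0} := by
  have hJ : closure (J A x : Set A) = (M A x : Set A) := not_not.1 hx
  have hmem : (⟨f, hf⟩ : A) ∈ closure (J A x : Set A) := by
    rw [hJ]
    exact hfx
  exact map_mem_closure (f := ((↑) : A → C(X, ℂ))) continuous_subtype_val hmem
    fun g hg => ⟨g.2, hg⟩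

/-- At two distinct points `x`, `y` outside `E`, `M_x ∩ M_y` is the closure of `J_x ∩ J_y`. The ideals
`M_x` and `M_y` are coprime, so `M_x ∩ M_y = M_x M_y`, and `J_x J_y ⊆ J_x ∩ J_y`. -/
theorem mem_closure_of_notMem_of_notMem [CompactSpace X]
    (hsep : ∀ x y : X, x ≠ y → ∃ f ∈ A, f x ≠ f y)
    {x y : X} (hxy : x ≠ y) (hx : x ∉ nonStronglyRegularSet A) (hy : y ∉ nonStronglyRegularSet A)
    {f : C(X, ℂ)} (hf : f ∈ A) (hfx : f x = 0) (hfy : f y = 0) :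
    f ∈ closure {g : C(X, ℂ) | g ∈ A ∧ (∀ᶠ z in 𝓝 x, g z = 0) ∧ ∀ᶠ z in 𝓝 y, g z = 0} := by
  obtain ⟨k, hk, hkxy⟩ := hsep x y hxy
  have hne : k y - k x ≠ 0 := sub_ne_zero.2 hkxy.symm
  set u : C(X, ℂ) := (k y - k x)⁻¹ • (k - k x • 1) with hu
  have huA : u ∈ A := A.smul_mem (A.sub_mem hk (A.smul_mem A.one_mem _)) _
  have hux : u x = 0 := by simp [hu]
  have huy : u y = 1 := by simp [hu, hne]
  have hfu := mem_closure_of_notMem_nonStronglyRegularSet hx huA hux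
  have hfv := mem_closure_of_notMem_nonStronglyRegularSet hy (A.sub_mem A.one_mem huA)
    (show (1 - u) y = 0 by simp [huy])
  have hff := mem_closure_of_notMem_nonStronglyRegularSet hx hf hfx
  have hff' := mem_closure_of_notMem_nonStronglyRegularSet hy hf hfy
  -- `u ∈ M_x`, `1 - u ∈ M_y` and `f ∈ M_x ∩ M_y`, so both summands lie in `M_x M_y`.
  have hsplit : f = u * f + f * (1 - u) := by ring
  rw [hsplit]
  have h1 := map_mem_closure₂ continuous_mul hfu hff'
    (u := {g : C(X, ℂ) | g ∈ A ∧ (∀ᶠ z in 𝓝 x, g z = 0) ∧ ∀ᶠ z in 𝓝 y, g z = 0})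
    fun a ha b hb => ⟨A.mul_mem ha.1 hb.1, ha.2.mono fun z hz => by simp [hz],
      hb.2.mono fun z hz => by simp [hz]⟩
  have h2 := map_mem_closure₂ continuous_mul hff hfv
    (u := {g : C(X, ℂ) | g ∈ A ∧ (∀ᶠ z in 𝓝 x, g z = 0) ∧ ∀ᶠ z in 𝓝 y, g z = 0})
    fun a ha b hb => ⟨A.mul_mem ha.1 hb.1, ha.2.mono fun z hz => by simp [hz],
      hb.2.mono fun z hz => by simp [hz]⟩
  exact map_mem_closure₂ continuous_add h1 h2
    fun a ha b hb => ⟨A.add_mem ha.1 hb.1,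
      (ha.2.1.and hb.2.1).mono fun z hz => by simp [hz.1, hz.2],
      (ha.2.2.and hb.2.2).mono fun z hz => by simp [hz.1, hz.2]⟩

end General

/-! ### The interval -/

theorem isTrivial_unitInterval {A : Subalgebra ℂ C(unitInterval, ℂ)} (hA : IsUniformAlgebra A)
    (hloc : IsTwoLocal A) (hE : Dense (nonStronglyRegularSet A)ᶜ) : IsTrivial A := by
  have hcl := hA.isComplete.isClosed
  have htop : Subalgebra.toSubmodule A = ⊤ := by
    refine eq_top_of_comp_min (by simpa using hcl) A.one_mem (fun a b hab => ?_) hE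
      fun x hx f hf => ?_
    · obtain ⟨f, hf, hne⟩ := hA.separatesPoints b a hab.ne'
      exact ⟨f, hf, b, ⟨hab.le, le_rfl⟩, hne⟩
    · have hf' : f - f x • 1 ∈ A := A.sub_mem hf (A.smul_mem A.one_mem _)
      have hcut := hloc.exists_indicator hcl (K := Iic x) (f := f - f x • 1)
        (closure_mono ?_ (mem_closure_of_notMem_nonStronglyRegularSet hx hf' (by simp)))
      swap
      · rintro g ⟨hgA, hg⟩
        refine ⟨hgA, fun p hp => ?_⟩
        rwa [mem_singleton_iff.1 (frontier_Iic_subset x hp)]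
      obtain ⟨h, hh, hh'⟩ := hcut
      refine ⟨h + f x • 1, A.add_mem hh (A.smul_mem A.one_mem _), fun t => ?_⟩
      rcases le_or_gt t x with ht | ht
      · simp [hh', ht]
      · simp [hh', ht.not_ge, ht.le]
  exact Algebra.toSubmodule_eq_top.1 htop

/-! ### Loops and the circle -/

theorem isometry_comp_of_surjective {X : Type*} [TopologicalSpace X] [CompactSpace X]
    {π : C(unitInterval, X)} (hsurj : Function.Surjective π) :
    Isometry (fun f : C(X, ℂ) => f.comp π) := by
  refine Isometry.of_dist_eq fun f g => le_antisymm ?_ ?_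
  · exact (ContinuousMap.dist_le dist_nonneg).2 fun t => ContinuousMap.dist_apply_le_dist (π t)
  · refine (ContinuousMap.dist_le dist_nonneg).2 fun x => ?_
    obtain ⟨t, rfl⟩ := hsurj x
    exact ContinuousMap.dist_apply_le_dist (f := f.comp π) (g := g.comp π) t

section Loop

variable {X : Type*} [TopologicalSpace X] [T2Space X] {π : C(unitInterval, X)}

theorem isOpen_image_of_subset_Ioo (hsurj : Function.Surjective π)
    (hinj : ∀ s ∈ Ioo (0 : unitInterval) 1, ∀ t, π s = π t → s = t)
    {V : Set unitInterval} (hV : IsOpen V) (hV' : V ⊆ Ioo 0 1) : IsOpen (π '' V) := by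
  have hcompl : (π '' V)ᶜ = π '' Vᶜ := by
    ext x
    constructor
    · intro hx
      obtain ⟨t, rfl⟩ := hsurj x
      exact ⟨t, fun ht => hx ⟨t, ht, rfl⟩, rfl⟩
    · rintro ⟨t, ht, rfl⟩ ⟨s, hs, hst⟩
      exact ht (hinj s (hV' hs) t hst ▸ hs)
  rw [← isClosed_compl_iff, hcompl]
  exact (hV.isClosed_compl.isCompact.image π.continuous).isClosed

theorem frontier_image_Iic_subset (hsurj : Function.Surjective π)
    (hinj : ∀ s ∈ Ioo (0 : unitInterval) 1, ∀ t, π s = π t → s = t)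
    {x : unitInterval} (hx : x < 1) : frontier (π '' Iic x) ⊆ {π 0, π x} := by
  have hclosed : IsClosed (π '' Iic x) := (isClosed_Iic.isCompact.image π.continuous).isClosed
  have hopen : IsOpen (π '' Ioo 0 x) := isOpen_image_of_subset_Ioo hsurj hinj isOpen_Ioo
    (Ioo_subset_Ioo_right hx.le)
  rw [hclosed.frontier_eq]
  rintro _ ⟨⟨t, ht, rfl⟩, hnot⟩
  rcases (show t ≤ x from ht).eq_or_lt with rfl | htx
  · exact Or.inr rfl
  rcases (unitInterval.nonneg' (t := t)).eq_or_lt with h0 | h0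
  · exact Or.inl (by rw [h0])
  · exact absurd (interior_maximal (image_mono fun s hs => hs.2.le) hopen
      (mem_image_of_mem π (show t ∈ Ioo 0 x from ⟨h0, htx⟩))) hnot

/-- The parametrization is open on the open interval, so dense sets pull back to dense sets. -/
theorem dense_Ioo_inter_preimage (hsurj : Function.Surjective π)
    (hinj : ∀ s ∈ Ioo (0 : unitInterval) 1, ∀ t, π s = π t → s = t)
    {S : Set X} (hS : Dense S) : Dense (Ioo 0 1 ∩ π ⁻¹' S) := by
  have hIoo : Dense (Ioo (0 : unitInterval) 1) := by
    refine (dense_univ.sdiff_finite (toFinite {0, 1})).mono fun t ht => ?_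
    have ht' : t ≠ 0 ∧ t ≠ 1 := by simpa using ht
    exact ⟨unitInterval.pos_iff_ne_zero.2 ht'.1, unitInterval.lt_one_iff_ne_one.2 ht'.2⟩
  rw [dense_iff_inter_open]
  intro U hU hne
  obtain ⟨_, ⟨t, ht, rfl⟩, htS⟩ := hS.inter_open_nonempty (π '' (U ∩ Ioo 0 1))
    (isOpen_image_of_subset_Ioo hsurj hinj (hU.inter isOpen_Ioo) inter_subset_right)
    ((hIoo.inter_open_nonempty U hU hne).image π)
  exact ⟨t, ht.1, ht.2, htS⟩

/-- The functions `b` on the interval such that multiplication by `b` preserves the space of all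
`f ∘ π` with `f ∈ A`, `f q = 0`. If `π` identifies the endpoints, these include functions that do
not factor through `π`. -/
def multiplierSpace (A : Subalgebra ℂ C(X, ℂ)) (π : C(unitInterval, X)) (q : X) :
    Submodule ℂ C(unitInterval, ℂ) where
  carrier := {b | ∀ f ∈ A, f q = 0 → ∃ g ∈ A, g q = 0 ∧ ∀ t, g (π t) = b t * f (π t)}
  zero_mem' f _ _ := ⟨0, A.zero_mem, rfl, fun t => by simp⟩
  add_mem' {b c} hb hc f hf hq := by
    obtain ⟨g, hg, hgq, hg'⟩ := hb f hf hq
    obtain ⟨h, hh, hhq, hh'⟩ := hc f hf hq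
    exact ⟨g + h, A.add_mem hg hh, by simp [hgq, hhq], fun t => by simp [hg', hh', add_mul]⟩
  smul_mem' c b hb f hf hq := by
    obtain ⟨g, hg, hgq, hg'⟩ := hb f hf hq
    exact ⟨c • g, A.smul_mem hg c, by simp [hgq], fun t => by simp [hg', mul_assoc]⟩

variable [CompactSpace X] {A : Subalgebra ℂ C(X, ℂ)} {q : X}

theorem isClosed_multiplierSpace (hcl : IsClosed (A : Set C(X, ℂ)))
    (hsurj : Function.Surjective π) :
    IsClosed (multiplierSpace A π q : Set C(unitInterval, ℂ)) := by
  have hN : IsClosed ((fun f : C(X, ℂ) => f.comp π) '' {f | f ∈ A ∧ f q = 0}) :=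
    (isometry_comp_of_surjective hsurj).isClosedEmbedding.isClosedMap _
      (hcl.inter (isClosed_eq (continuous_eval_const q) continuous_const))
  refine isClosed_of_closure_subset fun b hb f hf hq => ?_
  have hmem : b * f.comp π ∈ (fun f : C(X, ℂ) => f.comp π) '' {f | f ∈ A ∧ f q = 0} := by
    rw [← hN.closure_eq]
    refine map_mem_closure (f := fun b => b * f.comp π) (by fun_prop) hb fun c hc => ?_
    obtain ⟨g, hg, hgq, hg'⟩ := hc f hf hq
    exact ⟨g, ⟨hg, hgq⟩, ContinuousMap.ext hg'⟩
  obtain ⟨g, ⟨hg, hgq⟩, hg'⟩ := hmem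
  exact ⟨g, hg, hgq, fun t => DFunLike.congr_fun hg' t⟩

/-- Stopping a multiplier `b` at `x` changes the product `b * f` by a cut: `(b (min · x) - b x) * f`
is `(b - b x) * f` on the arc `π [0, x]` and `0` off it, and `(b - b x) * f` vanishes at both
endpoints of that arc. -/
theorem multiplierSpace_eq_top (hA : IsUniformAlgebra A) (hloc : IsTwoLocal A)
    (hE : Dense (nonStronglyRegularSet A)ᶜ) (hsurj : Function.Surjective π)
    (hinj : ∀ s ∈ Ioo (0 : unitInterval) 1, ∀ t, π s = π t → s = t)
    (h01 : π 0 = π 1) (hq : π 0 ∉ nonStronglyRegularSet A) :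
    multiplierSpace A π (π 0) = ⊤ := by
  have hcl := hA.isComplete.isClosed
  refine eq_top_of_comp_min (isClosed_multiplierSpace hcl hsurj)
    (fun f hf hq => ⟨f, hf, hq, fun t => by simp⟩) (fun a b hab => ?_)
    (dense_Ioo_inter_preimage hsurj hinj hE) ?_
  · obtain ⟨c, hac, hcb⟩ := exists_between hab
    have hc : c ∈ Ioo (0 : unitInterval) 1 :=
      ⟨unitInterval.nonneg'.trans_lt hac, hcb.trans_le unitInterval.le_one'⟩
    obtain ⟨k, hk, hne⟩ := hA.separatesPoints (π c) (π a) fun h => hac.ne' (hinj c hc a h)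
    exact ⟨k.comp π, fun f hf hq => ⟨k * f, A.mul_mem hk hf, by simp [hq], fun t => rfl⟩,
      c, ⟨hac.le, hcb.le⟩, hne⟩
  · rintro x ⟨hx, hxE⟩ b hb
    -- With `k ∘ π = b * (f ∘ π)`, the function `k - b x • f` vanishes at `π 0` and at `π x`.
    refine ⟨⟨fun t => b (min t x), by fun_prop⟩, fun f hf hfq => ?_, fun t => rfl⟩
    obtain ⟨k, hk, hkq, hk'⟩ := hb f hf hfq
    have hcut := hloc.exists_indicator hcl (K := π '' Iic x) (f := k - b x • f) (closure_mono ?_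
      (mem_closure_of_notMem_of_notMem hA.separatesPoints
        (fun h => hx.1.ne' (hinj x hx 0 h.symm)) hq hxE (A.sub_mem hk (A.smul_mem hf _))
        (by simp [hkq, hfq]) (by simp [hk'])))
    swap
    · rintro g ⟨hgA, hg0, hgx⟩
      refine ⟨hgA, fun p hp => ?_⟩
      rcases frontier_image_Iic_subset hsurj hinj hx.2 hp with rfl | rfl
      exacts [hg0, hgx]
    obtain ⟨h, hh, hh'⟩ := hcut
    have hval : ∀ t, (h + b x • f) (π t) = b (min t x) * f (π t) := by
      intro t
      rcases le_or_gt t x with ht | ht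
      · have : π t ∈ π '' Iic x := mem_image_of_mem π ht
        simp [hh', this, hk', ht]
      rcases (unitInterval.le_one' (t := t)).eq_or_lt with rfl | ht1
      · -- The endpoint `1` is mapped into the arc `π '' Iic x`, but everything vanishes there.
        have : π 1 ∈ π '' Iic x := ⟨0, unitInterval.nonneg', h01⟩
        rw [← h01] at this ⊢
        simp [hh', this, hkq, hfq]
      · have : π t ∉ π '' Iic x := by
          rintro ⟨s, hs, hst⟩
          exact ht.not_ge (hinj t ⟨hx.1.trans ht, ht1⟩ s hst.symm ▸ hs)
        simp [hh', this, ht.le]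
    refine ⟨h + b x • f, A.add_mem hh (A.smul_mem hf _), ?_, hval⟩
    rw [hval, hfq, mul_zero]

/-- Since every function on the interval is a multiplier, the ideal `M_q` of `A` is a closed ideal of
`C(X)`. Its only common zero is `q`, so it consists of all continuous functions vanishing at `q`. -/
theorem isTrivial_of_loop (hA : IsUniformAlgebra A) (hloc : IsTwoLocal A)
    (hE : Dense (nonStronglyRegularSet A)ᶜ) (hsurj : Function.Surjective π)
    (hinj : ∀ s ∈ Ioo (0 : unitInterval) 1, ∀ t, π s = π t → s = t)
    (h01 : π 0 = π 1) (hq : π 0 ∉ nonStronglyRegularSet A) : IsTrivial A := by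
  have htop := multiplierSpace_eq_top hA hloc hE hsurj hinj h01 hq
  -- `M_q`, as an ideal of `C(X)` rather than of `A`.
  let I : Ideal C(X, ℂ) :=
    { carrier := {f | f ∈ A ∧ f (π 0) = 0}
      zero_mem' := ⟨A.zero_mem, rfl⟩
      add_mem' := fun {f g} hf hg => ⟨A.add_mem hf.1 hg.1, by simp [hf.2, hg.2]⟩
      smul_mem' := fun c f hf => by
        have hc : c.comp π ∈ multiplierSpace A π (π 0) := htop ▸ Submodule.mem_top
        obtain ⟨g, hg, hgq, hg'⟩ := hc f hf.1 hf.2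
        have : c • f = g := by
          ext x
          obtain ⟨t, rfl⟩ := hsurj x
          exact (hg' t).symm
        rw [this]
        exact ⟨hg, hgq⟩ }
  have hI : IsClosed (I : Set C(X, ℂ)) := hA.isComplete.isClosed.inter
    (isClosed_eq (continuous_eval_const (π 0)) continuous_const)
  refine eq_top_iff.2 fun f _ => ?_
  have hf : f - f (π 0) • 1 ∈ I := by
    rw [← ContinuousMap.idealOfSet_ofIdeal_isClosed hI, ContinuousMap.mem_idealOfSet]
    intro x hx
    have hx0 : x = π 0 := by
      by_contra hne
      obtain ⟨k, hk, hkx⟩ := hA.separatesPoints x (π 0) hne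
      refine hx (ContinuousMap.mem_setOfIdeal.2 ⟨k - k (π 0) • 1,
        ⟨A.sub_mem hk (A.smul_mem A.one_mem _), by simp⟩, ?_⟩)
      simpa using sub_ne_zero.2 hkx
    simp [hx0]
  simpa using A.add_mem hf.1 (A.smul_mem A.one_mem (f (π 0)))

end Loop

theorem isTrivial_circle {A : Subalgebra ℂ C(Circle, ℂ)} (hA : IsUniformAlgebra A)
    (hloc : IsTwoLocal A) (hE : Dense (nonStronglyRegularSet A)ᶜ) : IsTrivial A := by
  obtain ⟨q, hq⟩ := hE.nonempty
  let π : C(unitInterval, Circle) := ⟨fun t => q * Circle.exp (t * (2 * Real.pi)), by fun_prop⟩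
  have hπ : ∀ t, π t = q * Circle.exp (t * (2 * Real.pi)) := fun t => rfl
  have h2π : (2 * Real.pi) ≠ 0 := by positivity
  have h0 : π 0 = q := by simp [hπ]
  refine isTrivial_of_loop (π := π) hA hloc hE ?_ ?_ ?_ (h0.symm ▸ hq)
  · intro z
    obtain ⟨r, hr⟩ := Circle.exp_surjective (q⁻¹ * z)
    refine ⟨⟨Int.fract (r / (2 * Real.pi)), Int.fract_nonneg _, (Int.fract_lt_one _).le⟩, ?_⟩
    have : Circle.exp (Int.fract (r / (2 * Real.pi)) * (2 * Real.pi)) = Circle.exp r := by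
      refine Circle.exp_eq_exp.2 ⟨-⌊r / (2 * Real.pi)⌋, ?_⟩
      rw [← Int.self_sub_floor, sub_mul, div_mul_cancel₀ _ h2π]
      push_cast
      ring
    rw [hπ]
    simp only [this, hr, mul_inv_cancel_left]
  · intro s hs t hst
    obtain ⟨m, hm⟩ := Circle.exp_eq_exp.1 (mul_left_cancel hst)
    have hst' : (s : ℝ) = t + m := by
      apply mul_right_cancel₀ h2π
      rw [hm]
      ring
    have hs0 : (0 : ℝ) < s := hs.1
    have hs1 : (s : ℝ) < 1 := hs.2
    have hm1 : (m : ℝ) < 1 := by linarith [t.2.1]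
    have hm2 : (-1 : ℝ) < m := by linarith [t.2.2]
    have hm0 : m = 0 := by
      have h1 : m < 1 := by exact_mod_cast hm1
      have h2 : -1 < m := by exact_mod_cast hm2
      omega
    exact Subtype.ext (by simpa [hm0] using hst')
  · simp [hπ]

end UniformAlg

theorem theorem11 :
    (∀ A : Subalgebra ℂ C(Set.Icc (0 : ℝ) 1, ℂ), UniformAlg.IsUniformAlgebra A →
      UniformAlg.IsTwoLocal A → IsMeagre (UniformAlg.nonStronglyRegularSet A) →
      UniformAlg.IsTrivial A) ∧
    (∀ A : Subalgebra ℂ C(Circle, ℂ), UniformAlg.IsUniformAlgebra A →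
      UniformAlg.IsTwoLocal A → IsMeagre (UniformAlg.nonStronglyRegularSet A) →
      UniformAlg.IsTrivial A) := by
  exact ⟨fun _ hA hloc hE => UniformAlg.isTrivial_unitInterval hA hloc (dense_of_mem_residual hE),
    fun _ hA hloc hE => UniformAlg.isTrivial_circle hA hloc (dense_of_mem_residual hE)⟩
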